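/- **Setting.** Let $\mathbb K$ be a commutative ring, $G$ a group, and $S_1,\dots,S_m\subset G$ subgroups with $S_i\cap S_j=\{1\}$ for $i\neq j$; write $\mathcal S$ for this family. For a left $\mathbb K[G]$-module $M$ let $H_*(G,\mathcal S;M)$ and $H^*(G,\mathcal S;M)$ be the relative (co)homology of the pair in the sense of Bieri–Eckmann, i.e. the homology of the mapping cone of $\bigoplus_k C_*(S_k;M)\to C_*(G;M)$ and the cohomology of the (shifted) mapping cone of the restriction $C^*(G;M)\to\bigoplus_k C^*(S_k;M)$, where $C_*$, $C^*$ are the bar complexes. Thus a relative $1$-cocycle is a pair $(f,(a_k)_k)$ of a $1$-cocycle $f:G\to M$ and elements $a_k\in M$ with $f(s)=s a_k-a_k$ for all $s\in S_k$. The pair $(G,\mathcal S)$ is a $\mathbb K$-$\mathrm{PD}_2$ pair if there is a class $e\in H_2(G,\mathcal S;\mathbb K)$ (trivial coefficients) such that the cap products $e\cap-:H^i(G,\mathcal S;M)\to H_{2-i}(G;M)$ and $e\cap-:H^i(G;M)\to H_{2-i}(G,\mathcal S;M)$ are isomorphisms for all $i\in\mathbb Z$ and all $\mathbb K[G]$-modules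 $M$. Let $\mathrm{aug}:\mathbb K[G]\to\mathbb K$ be the augmentation. A *Fox pairing* is a $\mathbb K$-bilinear map $\eta:\mathbb K[G]\times\mathbb K[G]\to\mathbb K[G]$ with $$\eta(a_1a_2,b)=\eta(a_1,b)\,\mathrm{aug}(a_2)+a_1\eta(a_2,b),\qquad \eta(a,b_1b_2)=\eta(a,b_1)b_2+\mathrm{aug}(b_1)\eta(a,b_2).$$ A *left* (resp. *right*) *derivation* is a $\mathbb K$-linear map $D:\mathbb K[G]\to\mathbb K[G]$ with $D(ab)=D(a)\,\mathrm{aug}(b)+aD(b)$ (resp. $D(ab)=D(a)b+\mathrm{aug}(a)D(b)$). If $D_l$ is a left derivation, $D_r$ a right derivation and $\nu:\mathbb K[G]\otimes_{\mathbb K[G]}\mathbb K[G]\to\mathbb K[G]$ a bimodule homomorphism, then $(a,b)\mapsto\nu(D_l(a),D_r(b))$ is a Fox pairing, said here to be *of derivation type*. Let $B=H^1(G;\mathbb K[G])=Z^1_r/B^1_r$ be formed with respect to the right multiplication of $G$ on $\mathbb K[G]$, where $Z^1_r=\{D:G\to\mathbb K[G]\mid D(gh)=D(g)h+D(h)\}$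 and $B^1_r=\{g\mapsto cg-c\mid c\in\mathbb K[G]\}$; it is a left $\mathbb K[G]$-module through $(gD)(h)=gD(h)$. A Fox pairing $\eta$ defines a $1$-cocycle $[\eta]:G\to B$, $g\mapsto[\eta(g,\cdot)]$. It *represents* a class in $H^1(G;B)$ if that is the class of $[\eta]$, and it represents a class in $H^1(G,\mathcal S;B)$ if that is the class of a relative cocycle $([\eta],(a_k)_k)$ for some $a_k\in B$. **Theorem.** Let $(G,\mathcal S)$ be a $\mathbb K$-$\mathrm{PD}_2$ pair with $m\ge1$. Then every class in $H^1(G,\mathcal S;H^1(G;\mathbb K[G]))$ and every class in $H^1(G;H^1(G;\mathbb K[G]))$ is represented by a Fox pairing; moreover every $1$-cocycle $f:G\to B$ that vanishes on each $S_k$ is of the form $f=[\eta]$ for a Fox pairing $\eta$. If $\mathbb K$ is a principal ideal domain, then in all three assertions $\eta$ can be chosen to be a finite sum of Fox pairings of derivation type. -/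

import Mathlib

universe u

noncomputable section
namespace PDPair
open Finsupp
section bar
variable {K H : Type u} [CommRing K] [Group H]

/-- Inhomogeneous `n`-cochains of a group `H` with coefficients in the `K[H]`-module `M`. -/
abbrev Cochain (M : Rep.{u} K H) (n : ℕ) : Type u := (Fin n → H) → M
/-- Inhomogeneous `n`-chains, i.e. the module `M ⊗ F_n` with `F_n` the bar resolution;
`single [h₁|…|hₙ] m` stands for `m ⊗ [h₁|…|hₙ]`. -/
abbrev Chain (M : Rep.{u} K H) (n : ℕ) : Type u := (Fin n → H) →₀ M
/-- The differential of Mathlib computing group cohomology. -/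
def coboundary (M : Rep.{u} K H) (n : ℕ) : Cochain M n →ₗ[K] Cochain M (n + 1) :=
  (inhomogeneousCochains.d M n).hom
/-- The differential of Mathlib computing group homology. -/
def boundary (M : Rep.{u} K H) (n : ℕ) : Chain M (n + 1) →ₗ[K] Chain M n :=
  (groupHomology.inhomogeneousChains.d M n).hom

/-- The trivial coefficient module `K`. -/
abbrev trivialRep (K H : Type u) [CommRing K] [Group H] : Rep.{u} K H :=
  Rep.of (Representation.trivial K H K)

/-- The first `p` entries of an `n`-tuple, `n = p + q`. -/
def front {α : Type u} {p q n : ℕ} (h : p + q = n) (g : Fin n → α) : Fin p → α :=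
  fun i => g (Fin.castLE (by omega) i)
/-- The last `q` entries of an `n`-tuple, `n = p + q`. -/
def back {α : Type u} {p q n : ℕ} (h : p + q = n) (g : Fin n → α) : Fin q → α :=
  fun i => g ⟨p + i, by omega⟩

/-- The chain level cap product of a chain with coefficients in `K` and a cochain with coefficients
in `M`: `[h₁|…|hₙ] ∩ f = (h₁⋯h_p)⁻¹ f(h₁,…,h_p) ⊗ [h_{p+1}|…|hₙ]`. -/
def cap (M : Rep.{u} K H) {p q n : ℕ} (h : p + q = n) (x : (Fin n → H) →₀ K) :
    Cochain M p →ₗ[K] Chain M q where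
  toFun f := x.sum fun g c => single (back h g)
    (c • M.ρ (Fin.partialProd g ⟨p, by omega⟩)⁻¹ (f (front h g)))
  map_add' f₁ f₂ := by
    simp [Finsupp.sum, Finset.sum_add_distrib]
  map_smul' r f := by
    simp [Finsupp.sum, Finset.smul_sum, smul_comm r]


theorem cap_single (M : Rep.{u} K H) {p q n : ℕ} (h : p + q = n) (g : Fin n → H) (c : K)
    (f : Cochain M p) : cap M h (single g c) f = single (back h g)
      (c • M.ρ (Fin.partialProd g ⟨p, by omega⟩)⁻¹ (f (front h g))) := by
  simp [cap]

theorem cap_add (M : Rep.{u} K H) {p q n : ℕ} (h : p + q = n) (x y : (Fin n → H) →₀ K)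
    (f : Cochain M p) : cap M h (x + y) f = cap M h x f + cap M h y f := by
  simp only [cap, LinearMap.coe_mk, AddHom.coe_mk]
  apply Finsupp.sum_add_index' <;> simp [add_smul]

theorem cap_smul (M : Rep.{u} K H) {p q n : ℕ} (h : p + q = n) (r : K) (x : (Fin n → H) →₀ K)
    (f : Cochain M p) : cap M h (r • x) f = r • cap M h x f := by
  simp only [cap, LinearMap.coe_mk, AddHom.coe_mk]
  rw [Finsupp.sum_smul_index' (by simp), Finsupp.smul_sum]
  simp [mul_smul]

/-- The cap product with a fixed cochain, as a linear map in the chain. -/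
def capL (M : Rep.{u} K H) {p q n : ℕ} (h : p + q = n) (f : Cochain M p) :
    ((Fin n → H) →₀ K) →ₗ[K] Chain M q where
  toFun x := cap M h x f
  map_add' x y := cap_add M h x y f
  map_smul' r x := cap_smul M h r x f

theorem capL_apply (M : Rep.{u} K H) {p q n : ℕ} (h : p + q = n) (f : Cochain M p) (x) :
    capL M h f x = cap M h x f := rfl

/-- The Leibniz rule `∂x ∩ f = x ∩ δf + (-1)^p ∂(x ∩ f)`. -/
theorem leibniz (M : Rep.{u} K H) {p q n : ℕ} (h : p + q = n) (x : (Fin (n + 1) → H) →₀ K)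
    (f : Cochain M p) :
    cap M h (boundary (trivialRep K H) n x) f =
      cap M (by omega : p + 1 + q = n + 1) x (coboundary M p f) +
        (-1 : K) ^ p • boundary M q (cap M (by omega : p + (q + 1) = n + 1) x f) := by
  subst h
  induction x using Finsupp.induction_linear with
  | zero => simp [cap]
  | add x y hx hy => 
    rw [cap_add, cap_add, map_add, cap_add, hx, hy, map_add, smul_add]; abel
  | single g c =>
    have e1 : boundary (trivialRep K H) (p + q) (single g c) = 
      single (fun i => g i.succ) c +
      Finset.univ.sum fun j : Fin (p + q + 1) =>
        (-1 : K) ^ ((j : ℕ) + 1) • single (Fin.contractNth j (· * ·) g) c := by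
      exact (groupHomology.inhomogeneousChains.d_single (A := trivialRep K H) (p + q) g c)
    have e2 : ∀ m, boundary M q (single (back (by omega : p + (q + 1) = p + q + 1) g) m) = 
      single (fun i => back (by omega : p + (q + 1) = p + q + 1) g i.succ) (M.ρ (back (by omega : p + (q + 1) = p + q + 1) g 0)⁻¹ m) +
      Finset.univ.sum fun j : Fin (q + 1) =>
        (-1 : K) ^ ((j : ℕ) + 1) • single (Fin.contractNth j (· * ·) (back (by omega : p + (q + 1) = p + q + 1) g)) m := fun m =>
      (groupHomology.inhomogeneousChains.d_single (A := M) q _ m)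
    have e3 : ∀ g' : Fin (p + 1) → H, coboundary M p f g' = 
      M.ρ (g' 0) (f fun i => g' i.succ) + Finset.univ.sum fun j : Fin (p + 1) =>
        (-1 : K) ^ ((j : ℕ) + 1) • f (Fin.contractNth j (· * ·) g') := fun g' =>
      inhomogeneousCochains.d_hom_apply M p f g'
    rw [e1, ← capL_apply, map_add, map_sum]
    simp only [map_smul, capL_apply, cap_single]
    rw [e2, e3, Fin.sum_univ_castSucc (n := p), 
      show (Finset.univ.sum fun j : Fin (p + q + 1) => (-1 : K) ^ ((j : ℕ) + 1) •
        single (back rfl (Fin.contractNth j (· * ·) g)) (c • M.ρ (Fin.partialProd (Fin.contractNth j (· * ·) g) ⟨p, by omega⟩)⁻¹ (f (front rfl (Fin.contractNth j (· * ·) g)))))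
       = _ from Fin.sum_univ_add (a := p) (b := q + 1) _]
    have b1 : (fun i => back (by omega : p + (q + 1) = p + q + 1) g i.succ) = back (by omega : p + 1 + q = p + q + 1) g := by
      funext i; simp only [back]; congr 1; ext; simp; omega
    have b2 : back (rfl : p + q = p + q) (fun i => g i.succ) = back (by omega : p + 1 + q = p + q + 1) g := by
      funext i; simp only [back]; congr 1; ext; simp; omega
    have b3 : ∀ j : Fin p, back (rfl : p + q = p + q) (Fin.contractNth (Fin.castAdd (q + 1) j : Fin (p + q + 1)) (· * ·) g) = back (by omega : p + 1 + q = p + q + 1) g := by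
      intro j
      funext i; simp only [back]
      rw [Fin.contractNth_apply_of_gt _ _ _ _ (by simp; omega)]
      congr 1; ext; simp; omega
    have b4 : ∀ j : Fin (q + 1), back (rfl : p + q = p + q) (Fin.contractNth (Fin.natAdd p j : Fin (p + q + 1)) (· * ·) g) = Fin.contractNth j (· * ·) (back (by omega : p + (q + 1) = p + q + 1) g) := by
      intro j
      funext i; simp only [back, Fin.contractNth, Fin.val_natAdd, add_lt_add_iff_left, add_right_inj]
      rfl
    have f1 : ∀ j : Fin (q + 1), front (rfl : p + q = p + q) (Fin.contractNth (Fin.natAdd p j : Fin (p + q + 1)) (· * ·) g) = front (by omega : p + (q + 1) = p + q + 1) g := by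
      intro j
      funext i; simp only [front]
      rw [Fin.contractNth_apply_of_lt _ _ _ _ (by simp; omega)]
      congr 1
    have f2 : ∀ j : Fin p, front (rfl : p + q = p + q) (Fin.contractNth (Fin.castAdd (q + 1) j : Fin (p + q + 1)) (· * ·) g) = Fin.contractNth j.castSucc (· * ·) (front (by omega : p + 1 + q = p + q + 1) g) := by
      intro j
      funext i; simp only [front, Fin.contractNth]
      rfl
    have f3 : (fun i : Fin p => front (by omega : p + 1 + q = p + q + 1) g i.succ) = front (rfl : p + q = p + q) (fun i => g i.succ) := by
      funext i; rfl
    have f4 : Fin.contractNth (Fin.last p) (· * ·) (front (by omega : p + 1 + q = p + q + 1) g) = front (by omega : p + (q + 1) = p + q + 1) g := by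
      funext i; rw [Fin.contractNth_apply_of_lt _ _ _ _ (by simp)]; rfl
    have p1 : ∀ j : Fin p, Fin.partialProd (Fin.contractNth (Fin.castAdd (q + 1) j : Fin (p + q + 1)) (· * ·) g) (⟨p, by omega⟩ : Fin (p + q + 1)) = Fin.partialProd g ⟨p + 1, by omega⟩ := by
      intro j
      rw [Fin.partialProd_contractNth]
      simp only [Function.comp]
      rw [Fin.succAbove_of_le_castSucc _ _ (by simp [Fin.le_def])]; rfl
    have p2 : ∀ j : Fin (q + 1), Fin.partialProd (Fin.contractNth (Fin.natAdd p j : Fin (p + q + 1)) (· * ·) g) (⟨p, by omega⟩ : Fin (p + q + 1)) = Fin.partialProd g ⟨p, by omega⟩ := by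
      intro j
      rw [Fin.partialProd_contractNth]
      simp only [Function.comp]
      rw [Fin.succAbove_of_castSucc_lt _ _ (by simp [Fin.lt_def])]; rfl
    have p3 : Fin.partialProd g ⟨p + 1, by omega⟩ = g 0 * Fin.partialProd (fun i => g i.succ) ⟨p, by omega⟩ := 
      Fin.partialProd_succ' g ⟨p, by omega⟩
    have p4 : Fin.partialProd g ⟨p + 1, by omega⟩ = Fin.partialProd g ⟨p, by omega⟩ * back (by omega : p + (q + 1) = p + q + 1) g 0 := 
      Fin.partialProd_succ g ⟨p, by omega⟩
    have r1 : ∀ v, M.ρ (back (by omega : p + (q + 1) = p + q + 1) g 0)⁻¹ (M.ρ (Fin.partialProd g ⟨p, by omega⟩)⁻¹ v) = M.ρ (Fin.partialProd g ⟨p + 1, by omega⟩)⁻¹ v := by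
      intro v; rw [p4, mul_inv_rev, map_mul]; rfl
    have r2 : ∀ v, M.ρ (Fin.partialProd g ⟨p + 1, by omega⟩)⁻¹ (M.ρ (front (by omega : p + 1 + q = p + q + 1) g 0) v) = M.ρ (Fin.partialProd (fun i => g i.succ) ⟨p, by omega⟩)⁻¹ v := by
      intro v; rw [← Module.End.mul_apply, ← map_mul, p3, mul_inv_rev]
      simp [front]
    simp only [b1, b2, b3, b4, f1, f2, f3, f4, p1, p2, map_add, map_sum, map_smul, r1, r2]
    simp only [smul_add, single_add, Finset.smul_sum, Finsupp.single_finsetSum, Fin.val_natAdd, Fin.val_castAdd, Fin.val_castSucc, Fin.val_last]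
    simp only [Finsupp.smul_single, smul_smul]
    have s1 : ∀ j : ℕ, (-1 : K) ^ (p + j + 1) * c = (-1) ^ p * ((-1) ^ (j + 1) * c) := by
      intro j; ring
    have s2 : ∀ j : ℕ, (-1 : K) ^ (j + 1) * c = c * (-1) ^ (j + 1) := fun j => mul_comm _ _
    have s3 : (-1 : K) ^ p * c = -(c * (-1) ^ (p + 1)) := by ring
    simp only [s1, s3, neg_smul, Finsupp.single_neg]
    simp only [s2]
    abel
end bar

section homology
variable {K : Type u} [CommRing K] {X : ℕ → Type u} [∀ n, AddCommGroup (X n)] [∀ n, Module K (X n)]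

/-- Cycles of a chain complex `⋯ → X 1 → X 0 → 0`. -/
def cycles (d : ∀ n, X (n + 1) →ₗ[K] X n) : ∀ n, Submodule K (X n)
  | 0 => ⊤
  | n + 1 => LinearMap.ker (d n)

/-- Homology of a chain complex `⋯ → X 1 → X 0 → 0`. -/
abbrev Homology (d : ∀ n, X (n + 1) →ₗ[K] X n) (n : ℕ) : Type u :=
  cycles d n ⧸ (LinearMap.range (d n)).submoduleOf (cycles d n)

/-- Cocycles of a cochain complex `0 → X 0 → X 1 → ⋯`. -/
abbrev cocycles (d : ∀ n, X n →ₗ[K] X (n + 1)) (n : ℕ) : Submodule K (X n) :=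
  LinearMap.ker (d n)

/-- Coboundaries of a cochain complex `0 → X 0 → X 1 → ⋯`. -/
def coboundaries (d : ∀ n, X n →ₗ[K] X (n + 1)) : ∀ n, Submodule K (X n)
  | 0 => ⊥
  | n + 1 => LinearMap.range (d n)

/-- Cohomology of a cochain complex `0 → X 0 → X 1 → ⋯`. -/
abbrev Cohomology (d : ∀ n, X n →ₗ[K] X (n + 1)) (n : ℕ) : Type u :=
  cocycles d n ⧸ (coboundaries d n).submoduleOf (cocycles d n)

/-- The shifted sequence: `Shift X n` is `X (n - 1)`, and is zero for `n = 0`. -/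
def Shift (X : ℕ → Type u) : ℕ → Type u
  | 0 => PUnit
  | n + 1 => X n

instance : ∀ n, AddCommGroup (Shift X n)
  | 0 => (inferInstance : AddCommGroup PUnit)
  | n + 1 => (inferInstance : AddCommGroup (X n))

instance : ∀ n, Module K (Shift X n)
  | 0 => (inferInstance : Module K PUnit.{u + 1})
  | n + 1 => (inferInstance : Module K (X n))

variable (K X) in
/-- The tautological identification `Shift X (n + 1) = X n`. -/
def shiftEquiv (n : ℕ) : Shift X (n + 1) ≃ₗ[K] X n := LinearEquiv.refl K (X n)

/-- A differential lowering degrees, on the shifted sequence. -/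
def shiftDown (d : ∀ n, X (n + 1) →ₗ[K] X n) : ∀ n, Shift X (n + 1) →ₗ[K] Shift X n
  | 0 => 0
  | n + 1 => (shiftEquiv K X n).symm ∘ₗ d n ∘ₗ shiftEquiv K X (n + 1)

/-- A differential raising degrees, on the shifted sequence. -/
def shiftUp (d : ∀ n, X n →ₗ[K] X (n + 1)) : ∀ n, Shift X n →ₗ[K] Shift X (n + 1)
  | 0 => 0
  | n + 1 => (shiftEquiv K X (n + 1)).symm ∘ₗ d n ∘ₗ shiftEquiv K X n

end homology

section relative
variable {K G : Type u} [CommRing K] [Group G] {m : ℕ} (S : Fin m → Subgroup G) (M : Rep.{u} K G)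

/-- The restriction of coefficients to a subgroup. -/
abbrev resRep (T : Subgroup G) : Rep.{u} K T := Rep.of (M.ρ.comp T.subtype)

/-- `⨁ₖ C_n(S_k; M)`. -/
abbrev FamChain (n : ℕ) : Type u := ∀ k : Fin m, Chain (resRep M (S k)) n
/-- `⨁ₖ C^n(S_k; M)`. -/
abbrev FamCochain (n : ℕ) : Type u := ∀ k, Cochain (resRep M (S k)) n

/-- The differential of `⨁ₖ C_*(S_k; M)`. -/
def famBoundary (n : ℕ) : FamChain S M (n + 1) →ₗ[K] FamChain S M n :=
  LinearMap.pi fun k => boundary (resRep M (S k)) n ∘ₗ LinearMap.proj k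

/-- The differential of `⨁ₖ C^*(S_k; M)`. -/
def famCoboundary (n : ℕ) : FamCochain S M n →ₗ[K] FamCochain S M (n + 1) :=
  LinearMap.pi fun k => coboundary (resRep M (S k)) n ∘ₗ LinearMap.proj k

/-- The map `⨁ₖ C_n(S_k; M) → C_n(G; M)` induced by the inclusions. -/
def push (n : ℕ) : FamChain S M n →ₗ[K] Chain M n :=
  ∑ k : Fin m, Finsupp.lmapDomain M K (fun (s : Fin n → S k) i => (s i : G)) ∘ₗ LinearMap.proj k

/-- The restriction map `C^n(G; M) → ⨁ₖ C^n(S_k; M)`. -/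
def restrict (n : ℕ) : Cochain M n →ₗ[K] FamCochain S M n where
  toFun f k s := f fun i => (s i : G)
  map_add' _ _ := rfl
  map_smul' _ _ := rfl

/-- Relative chains of `(G, S)`: the mapping cone of `⨁ₖ C_*(S_k; M) → C_*(G; M)`, in degree `n`
consisting of pairs `(x, y)` with `x ∈ C_n(G; M)` and `y ∈ ⨁ₖ C_{n-1}(S_k; M)`. -/
abbrev RelChain (n : ℕ) : Type u := Chain M n × Shift (FamChain S M) n
/-- Relative cochains of `(G, S)`: the (shifted) mapping cone of `C^*(G; M) → ⨁ₖ C^*(S_k; M)`, in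
degree `n` consisting of pairs `(f, a)` with `f ∈ C^n(G; M)` and `a ∈ ⨁ₖ C^{n-1}(S_k; M)`. -/
abbrev RelCochain (n : ℕ) : Type u := Cochain M n × Shift (FamCochain S M) n

/-- `∂(x, y) = (∂x + y, -∂y)`. -/
def relBoundary (n : ℕ) : RelChain S M (n + 1) →ₗ[K] RelChain S M n :=
  (boundary M n ∘ₗ LinearMap.fst K _ _ +
      push S M n ∘ₗ shiftEquiv K (FamChain S M) n ∘ₗ LinearMap.snd K _ _).prod
    (-(shiftDown (famBoundary S M) n ∘ₗ LinearMap.snd K _ _))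

/-- `δ(f, a) = (δf, f|_S - δa)`. -/
def relCoboundary (n : ℕ) : RelCochain S M n →ₗ[K] RelCochain S M (n + 1) :=
  (coboundary M n ∘ₗ LinearMap.fst K _ _).prod
    ((shiftEquiv K (FamCochain S M) n).symm ∘ₗ restrict S M n ∘ₗ LinearMap.fst K _ _ -
      shiftUp (famCoboundary S M) n ∘ₗ LinearMap.snd K _ _)

/-- The group cohomology `H^n(G; M)`. -/
abbrev GrpCohomology (n : ℕ) : Type u := Cohomology (coboundary M) n

/-- The relative cocycles of `(G, S)` with coefficients in `M`. -/
abbrev relCocycles (n : ℕ) : Submodule K (RelCochain S M n) := cocycles (relCoboundary S M) n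

/-- The relative group cohomology `H^n(G, S; M)`. -/
abbrev RelCohomology (n : ℕ) : Type u := Cohomology (relCoboundary S M) n

/-- The class of a relative cocycle. -/
def relClass (n : ℕ) : relCocycles S M n →ₗ[K] RelCohomology S M n := Submodule.mkQ _

/-- The 1-cocycles of `G` in `M` that vanish on each `S_k`. -/
def vanishingCocycles : Submodule K (Cochain M 1) :=
  cocycles (coboundary M) 1 ⊓ LinearMap.ker (restrict S M 1)

/-- The cap product in each `S_k`. -/
def famCap {p q n : ℕ} (h : p + q = n) (y : FamChain S (trivialRep K G) n) :
    FamCochain S M p →ₗ[K] FamChain S M q :=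
  LinearMap.pi fun k => cap (resRep M (S k)) h (y k) ∘ₗ LinearMap.proj k

/-- The cap product of the `S_k`-component of a relative chain with a cochain on the `S_k`. -/
def capShift : ∀ {p q n : ℕ}, p + q = n → Shift (FamChain S (trivialRep K G)) n →
    FamCochain S M p →ₗ[K] Shift (FamChain S M) q
  | _, 0, _, _, _ => 0
  | _, _ + 1, 0, h, _ => absurd h (by omega)
  | p, q + 1, n + 1, h, y => (shiftEquiv K (FamChain S M) q).symm ∘ₗ
      famCap S M (by omega : p + q = n) (shiftEquiv K (FamChain S (trivialRep K G)) n y)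

/-- The cap product of the `S_k`-component of a relative chain with the `S_k`-component of a relative
cochain, pushed to `G`. -/
def capPush : ∀ {p q n : ℕ}, p + q = n → Shift (FamChain S (trivialRep K G)) n →
    Shift (FamCochain S M) p →ₗ[K] Chain M q
  | 0, _, _, _, _ => 0
  | _ + 1, _, 0, h, _ => absurd h (by omega)
  | p + 1, q, n + 1, h, y => push S M q ∘ₗ
      famCap S M (by omega : p + q = n) (shiftEquiv K (FamChain S (trivialRep K G)) n y) ∘ₗ
        shiftEquiv K (FamCochain S M) p

/-- The cap product `(x, y) ∩ f = (x ∩ f, (-1)^p y ∩ f|_S)` of a relative chain and a cochain of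
degree `p`, which is a relative chain. -/
def relCap {p q n : ℕ} (h : p + q = n) (e : RelChain S (trivialRep K G) n) :
    Cochain M p →ₗ[K] RelChain S M q :=
  (cap M h e.1).prod ((-1 : K) ^ p • capShift S M h e.2 ∘ₗ restrict S M p)

/-- The cap product `(x, y) ∩ (f, a) = x ∩ f + y ∩ a` of a relative chain and a relative cochain,
which is a chain. -/
def capRel {p q n : ℕ} (h : p + q = n) (e : RelChain S (trivialRep K G) n) :
    RelCochain S M p →ₗ[K] Chain M q :=
  cap M h e.1 ∘ₗ LinearMap.fst K _ _ + capPush S M h e.2 ∘ₗ LinearMap.snd K _ _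

theorem push_boundary (n : ℕ) (y : FamChain S M (n + 1)) :
    boundary M n (push S M (n + 1) y) = push S M n (famBoundary S M n y) := by
  have key : ∀ k, boundary M n ∘ₗ Finsupp.lmapDomain M K (fun (s : Fin (n + 1) → S k) i => (s i : G)) =
      Finsupp.lmapDomain M K (fun (s : Fin n → S k) i => (s i : G)) ∘ₗ boundary (resRep M (S k)) n := by
    intro k
    refine Finsupp.lhom_ext fun g c => ?_
    have e1 := groupHomology.inhomogeneousChains.d_single (A := M) n (fun i => (g i : G)) c
    have e2 := groupHomology.inhomogeneousChains.d_single (A := resRep M (S k)) n g c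
    simp only [LinearMap.comp_apply, Finsupp.lmapDomain_apply, Finsupp.mapDomain_single, boundary]
    erw [e1, e2]
    simp only [Finsupp.mapDomain_add, Finsupp.mapDomain_finsetSum, Finsupp.mapDomain_smul, Finsupp.mapDomain_single]
    congr 1
    refine Finset.sum_congr rfl fun j _ => ?_
    congr 2
    funext i
    simp only [Fin.contractNth]
    split_ifs <;> rfl
  simp only [push, LinearMap.sum_apply, map_sum]
  exact Finset.sum_congr rfl fun k _ => LinearMap.congr_fun (key k) (y k)

theorem restrict_coboundary (n : ℕ) (f : Cochain M n) :
    restrict S M (n + 1) (coboundary M n f) = famCoboundary S M n (restrict S M n f) := by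
  funext k s
  have e1 := inhomogeneousCochains.d_hom_apply M n f (fun i => (s i : G))
  have e2 := inhomogeneousCochains.d_hom_apply (resRep M (S k)) n (restrict S M n f k) s
  refine e1.trans (Eq.trans ?_ e2.symm)
  simp only [restrict]
  congr 1
  refine Finset.sum_congr rfl fun j _ => ?_
  congr 1
  change f _ = f _
  congr 1
  funext i
  simp only [Fin.contractNth]
  split_ifs <;> rfl

theorem push_cap {p q n : ℕ} (h : p + q = n) (y : FamChain S (trivialRep K G) n)
    (f : Cochain M p) :
    cap M h (push S (trivialRep K G) n y) f =
      push S M q (famCap S M h y (restrict S M p f)) := by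
  have key : ∀ k, capL M h f ∘ₗ Finsupp.lmapDomain K K (fun (s : Fin n → S k) i => (s i : G)) =
      Finsupp.lmapDomain M K (fun (s : Fin q → S k) i => (s i : G)) ∘ₗ
        capL (resRep M (S k)) h (restrict S M p f k) := by
    intro k
    refine Finsupp.lhom_ext fun g c => ?_
    simp only [LinearMap.comp_apply, Finsupp.lmapDomain_apply, Finsupp.mapDomain_single, capL_apply,
      cap_single]
    have : Fin.partialProd (fun i => (g i : G)) ⟨p, by omega⟩ = 
       ((Fin.partialProd g ⟨p, by omega⟩ : S k) : G) := by
      simp [Fin.partialProd, List.map_take, List.map_ofFn, Function.comp_def]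
    rw [this]
    rfl
  have := capL_apply M h f (push S (trivialRep K G) n y)
  rw [← this]
  simp only [push, LinearMap.sum_apply, map_sum]
  exact Finset.sum_congr rfl fun k _ => LinearMap.congr_fun (key k) (y k)


theorem boundary_cap {H : Type u} [Group H] (M : Rep.{u} K H) {p q n : ℕ} (h : p + q = n)
    (x : (Fin (n + 1) → H) →₀ K) (f : Cochain M p) :
    boundary M q (cap M (by omega : p + (q + 1) = n + 1) x f) =
      (-1 : K) ^ p • (cap M h (boundary (trivialRep K H) n x) f -
        cap M (by omega : p + 1 + q = n + 1) x (coboundary M p f)) := by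
  rw [leibniz M h x f, add_sub_cancel_left, smul_smul, ← mul_pow]
  simp

theorem famBoundary_famCap {p q n : ℕ} (h : p + q = n) (y : FamChain S (trivialRep K G) (n + 1))
    (hy : famBoundary S (trivialRep K G) n y = 0) (f : FamCochain S M p) :
    famBoundary S M q (famCap S M (by omega : p + (q + 1) = n + 1) y f) =
      (-1 : K) ^ (p + 1) •
        famCap S M (by omega : p + 1 + q = n + 1) y (famCoboundary S M p f) := by
  funext k
  have hk : boundary (trivialRep K (S k)) n (y k) = 0 := congrFun hy k
  change boundary (resRep M (S k)) q (cap _ _ _ _) = (-1 : K) ^ (p + 1) • cap _ _ _ (coboundary _ _ _)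
  rw [boundary_cap _ h, hk, pow_succ]
  simp [cap]

theorem cap_neg (M : Rep.{u} K G) {p q n : ℕ} (h : p + q = n) (x : (Fin n → G) →₀ K)
    (f : Cochain M p) : cap M h (-x) f = -cap M h x f := map_neg (capL M h f) x

theorem boundary_of_mem_cycles {n : ℕ} (x : Chain (trivialRep K G) (n + 1))
    (y : FamChain S (trivialRep K G) n)
    (he : (x, (shiftEquiv K (FamChain S (trivialRep K G)) n).symm y) ∈
      cycles (relBoundary S (trivialRep K G)) (n + 1)) :
    boundary (trivialRep K G) n x = -push S (trivialRep K G) n y :=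
  eq_neg_of_add_eq_zero_left (congrArg Prod.fst he)

theorem famBoundary_of_mem_cycles {n : ℕ} (x : Chain (trivialRep K G) (n + 2))
    (y : FamChain S (trivialRep K G) (n + 1))
    (he : (x, (shiftEquiv K (FamChain S (trivialRep K G)) (n + 1)).symm y) ∈
      cycles (relBoundary S (trivialRep K G)) (n + 2)) :
    famBoundary S (trivialRep K G) n y = 0 :=
  neg_eq_zero.1 (congrArg Prod.snd he)

theorem relCap_cycle {p q n : ℕ} (h : p + q = n) (e : RelChain S (trivialRep K G) n)
    (he : e ∈ cycles (relBoundary S (trivialRep K G)) n) (f : Cochain M p)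
    (hf : f ∈ cocycles (coboundary M) p) :
    relCap S M h e f ∈ cycles (relBoundary S M) q := by
  cases q with
  | zero => trivial
  | succ q =>
    obtain ⟨n, rfl⟩ : ∃ n', n = n' + 1 := ⟨p + q, by omega⟩
    obtain ⟨x, y'⟩ := e
    obtain ⟨y, rfl⟩ := (shiftEquiv K (FamChain S (trivialRep K G)) n).symm.surjective y'
    have hf : coboundary M p f = 0 := hf
    have hpq : p + q = n := by omega
    have hx := boundary_of_mem_cycles S x y he
    refine Prod.ext ?_ ?_
    · change boundary M q (cap M h x f) +
        push S M q ((-1 : K) ^ p • famCap S M hpq y (restrict S M p f)) = 0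
      rw [boundary_cap M hpq, hf, hx, map_smul, ← push_cap, cap_neg]
      simp
    · have hr : famCoboundary S M p (restrict S M p f) = 0 := by
        rw [← restrict_coboundary, hf, map_zero]
      cases q with
      | zero => rfl
      | succ q =>
        obtain ⟨n, rfl⟩ : ∃ n', n = n' + 1 := ⟨p + q, by omega⟩
        have hy := famBoundary_of_mem_cycles S x y he
        change - famBoundary S M q ((-1 : K) ^ p • famCap S M hpq y (restrict S M p f)) = 0
        rw [map_smul, neg_eq_zero, famBoundary_famCap S M (by omega) y hy, hr]
        simp

theorem relCap_boundary {p q n : ℕ} (h : p + q = n) (e : RelChain S (trivialRep K G) n)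
    (he : e ∈ cycles (relBoundary S (trivialRep K G)) n) (f : Cochain M p)
    (hf : f ∈ coboundaries (coboundary M) p) :
    relCap S M h e f ∈ LinearMap.range (relBoundary S M q) := by
  cases p with
  | zero =>
    obtain rfl : f = 0 := hf
    rw [map_zero]; exact zero_mem _
  | succ p =>
    obtain ⟨n, rfl⟩ : ∃ n', n = n' + 1 := ⟨p + q, by omega⟩
    obtain ⟨b, rfl⟩ := hf
    obtain ⟨x, y'⟩ := e
    obtain ⟨y, rfl⟩ := (shiftEquiv K (FamChain S (trivialRep K G)) n).symm.surjective y'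
    have hpq : p + q = n := by omega
    have hx := boundary_of_mem_cycles S x y he
    have l := leibniz M hpq x b
    refine ⟨((-1 : K) ^ (p + 1) • cap M (by omega : p + (q + 1) = n + 1) x b,
      (shiftEquiv K (FamChain S M) q).symm (-famCap S M hpq y (restrict S M p b))), ?_⟩
    refine Prod.ext ?_ ?_
    · change boundary M q ((-1 : K) ^ (p + 1) • cap M _ x b) +
        push S M q (-famCap S M hpq y (restrict S M p b)) = cap M h x (coboundary M p b)
      rw [map_neg, ← push_cap, map_smul]
      rw [hx, cap_neg] at l
      rw [eq_sub_of_add_eq l.symm, pow_succ]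
      simp only [mul_neg, mul_one, neg_smul]
      abel
    · cases q with
      | zero => rfl
      | succ q =>
        obtain ⟨n, rfl⟩ : ∃ n', n = n' + 1 := ⟨p + q, by omega⟩
        have hy := famBoundary_of_mem_cycles S x y he
        change - famBoundary S M q (-famCap S M hpq y (restrict S M p b)) =
          (-1 : K) ^ (p + 1) • famCap S M (by omega : p + 1 + q = n + 1) y
            (restrict S M (p + 1) (coboundary M p b))
        rw [map_neg, neg_neg, restrict_coboundary, famBoundary_famCap S M (by omega) y hy]

theorem capRel_cycle {p q n : ℕ} (h : p + q = n) (e : RelChain S (trivialRep K G) n)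
    (he : e ∈ cycles (relBoundary S (trivialRep K G)) n) (z : RelCochain S M p)
    (hz : z ∈ cocycles (relCoboundary S M) p) :
    capRel S M h e z ∈ cycles (boundary M) q := by
  cases q with
  | zero => trivial
  | succ q =>
    obtain ⟨n, rfl⟩ : ∃ n', n = n' + 1 := ⟨p + q, by omega⟩
    obtain ⟨x, y'⟩ := e
    obtain ⟨y, rfl⟩ := (shiftEquiv K (FamChain S (trivialRep K G)) n).symm.surjective y'
    have hpq : p + q = n := by omega
    have hx := boundary_of_mem_cycles S x y he
    obtain ⟨f, a'⟩ := z
    have hf : coboundary M p f = 0 := congrArg Prod.fst hz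
    cases p with
    | zero =>
      have hr : restrict S M 0 f = 0 := by
        have := congrArg Prod.snd hz
        exact (sub_zero _).symm.trans this
      change boundary M q (cap M h x f + 0) = 0
      rw [add_zero, boundary_cap M hpq, hf, hx, cap_neg, push_cap, hr]
      simp
    | succ p =>
      obtain ⟨n, rfl⟩ : ∃ n', n = n' + 1 := ⟨p + q, by omega⟩
      obtain ⟨a, rfl⟩ := (shiftEquiv K (FamCochain S M) p).symm.surjective a'
      have hy := famBoundary_of_mem_cycles S x y he
      have hr : restrict S M (p + 1) f = famCoboundary S M p a :=
        sub_eq_zero.1 (congrArg Prod.snd hz)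
      change boundary M q (cap M h x f + push S M (q + 1)
        (famCap S M (by omega : p + (q + 1) = n + 1) y a)) = 0
      rw [map_add, boundary_cap M hpq, hf, hx, cap_neg, push_cap, hr, push_boundary,
        famBoundary_famCap S M (by omega) y hy]
      simp

theorem capRel_boundary {p q n : ℕ} (h : p + q = n) (e : RelChain S (trivialRep K G) n)
    (he : e ∈ cycles (relBoundary S (trivialRep K G)) n) (z : RelCochain S M p)
    (hz : z ∈ coboundaries (relCoboundary S M) p) :
    capRel S M h e z ∈ LinearMap.range (boundary M q) := by
  cases p with
  | zero =>
    obtain rfl : z = 0 := hz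
    rw [map_zero]; exact zero_mem _
  | succ p =>
    obtain ⟨n, rfl⟩ : ∃ n', n = n' + 1 := ⟨p + q, by omega⟩
    obtain ⟨⟨f, a'⟩, rfl⟩ := hz
    obtain ⟨x, y'⟩ := e
    obtain ⟨y, rfl⟩ := (shiftEquiv K (FamChain S (trivialRep K G)) n).symm.surjective y'
    have hpq : p + q = n := by omega
    have hx := boundary_of_mem_cycles S x y he
    have l := leibniz M hpq x f
    rw [hx, cap_neg, push_cap] at l
    have hb : (-1 : K) ^ p • boundary M q (cap M (by omega : p + (q + 1) = n + 1) x f) ∈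
        LinearMap.range (boundary M q) := Submodule.smul_mem _ _ ⟨_, rfl⟩
    cases p with
    | zero =>
      change cap M h x (coboundary M 0 f) +
        push S M q (famCap S M hpq y (restrict S M 0 f - 0)) ∈ _
      rw [eq_sub_of_add_eq l.symm, sub_zero]
      convert neg_mem hb using 1
      abel
    | succ p =>
      obtain ⟨n, rfl⟩ : ∃ n', n = n' + 1 := ⟨p + q, by omega⟩
      obtain ⟨a, rfl⟩ := (shiftEquiv K (FamCochain S M) p).symm.surjective a'
      have hy := famBoundary_of_mem_cycles S x y he
      have key := famBoundary_famCap S M (by omega : p + q = n) y hy a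
      have hmem : push S M q (famCap S M hpq y (famCoboundary S M p a)) ∈
          LinearMap.range (boundary M q) := by
        refine ⟨push S M (q + 1) ((-1 : K) ^ (p + 1) • famCap S M (by omega) y a), ?_⟩
        rw [push_boundary, map_smul, key, smul_smul, ← mul_pow]
        simp
      change cap M h x (coboundary M (p + 1) f) +
        push S M q (famCap S M hpq y (restrict S M (p + 1) f - famCoboundary S M p a)) ∈ _
      rw [eq_sub_of_add_eq l.symm, map_sub, map_sub]
      convert neg_mem (add_mem hb hmem) using 1
      abel

/-- The cap product `e ∩ - : H^p(G; M) → H_q(G, S; M)` with the class of a relative cycle `e`. -/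
def capAbs {p q n : ℕ} (h : p + q = n) (e : cycles (relBoundary S (trivialRep K G)) n) :
    Cohomology (coboundary M) p →ₗ[K] Homology (relBoundary S M) q :=
  Submodule.mapQ _ _
    ((relCap S M h e.1).restrict fun f hf => relCap_cycle S M h e.1 e.2 f hf)
    fun f hf => relCap_boundary S M h e.1 e.2 f.1 hf

/-- The cap product `e ∩ - : H^p(G, S; M) → H_q(G; M)` with the class of a relative cycle `e`. -/
def capFromRel {p q n : ℕ} (h : p + q = n) (e : cycles (relBoundary S (trivialRep K G)) n) :
    Cohomology (relCoboundary S M) p →ₗ[K] Homology (boundary M) q :=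
  Submodule.mapQ _ _
    ((capRel S M h e.1).restrict fun z hz => capRel_cycle S M h e.1 e.2 z hz)
    fun z hz => capRel_boundary S M h e.1 e.2 z.1 hz

/-- `(G, S)` is a `K`-Poincaré duality pair of dimension `n`: there is a class `e ∈ H_n(G, S; K)` such
that the cap products `H^i(G, S; M) → H_{n-i}(G; M)` and `H^i(G; M) → H_{n-i}(G, S; M)` with `e` are
isomorphisms for all `i` and all `K[G]`-modules `M`. When `i` or `n - i` is negative this says that
the other side is zero. -/
def IsPDPair (n : ℕ) : Prop :=
  ∃ e : cycles (relBoundary S (trivialRep K G)) n, ∀ M : Rep.{u} K G,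
    (∀ (p q : ℕ) (h : p + q = n),
      Function.Bijective (capAbs S M h e) ∧ Function.Bijective (capFromRel S M h e)) ∧
    ∀ i : ℕ, n < i →
      Subsingleton (Cohomology (coboundary M) i) ∧
      Subsingleton (Cohomology (relCoboundary S M) i) ∧
      Subsingleton (Homology (boundary M) i) ∧
      Subsingleton (Homology (relBoundary S M) i)

end relative

section rightH1
variable {K G A : Type u} [CommRing K] [Group G] [Ring A] [Algebra K A] (u : G →* A)

/-- The module `Z¹_r(G; A)` of maps `D : G → A` with `D(gh) = D(g)h + D(h)`, where `G` acts on the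
ring `A` through the homomorphism `u : G → A`; for the group ring `A = K[G]`, these are the
restrictions to `G` of the right derivations. -/
def rightCocycles : Submodule K (G → A) where
  carrier := {D | ∀ g h, D (g * h) = D g * u h + D h}
  zero_mem' := by simp
  add_mem' := by
    intro D E hD hE g h
    simp only [Pi.add_apply, hD g h, hE g h, add_mul]; abel
  smul_mem' := by
    intro c D hD g h
    simp only [Pi.smul_apply, hD g h, smul_add, smul_mul_assoc]

/-- The submodule `B¹_r(G; A)` of the maps `g ↦ cg - c`. -/
def rightCoboundaries : Submodule K (G → A) where
  carrier := {D | ∃ c, ∀ g, D g = c * u g - c}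
  zero_mem' := ⟨0, by simp⟩
  add_mem' := by
    rintro D E ⟨c, hc⟩ ⟨d, hd⟩
    refine ⟨c + d, fun g => ?_⟩
    simp only [Pi.add_apply, hc, hd, add_mul]; abel
  smul_mem' := by
    rintro r D ⟨c, hc⟩
    refine ⟨r • c, fun g => ?_⟩
    simp only [Pi.smul_apply, hc, smul_sub, smul_mul_assoc]

variable (K) in
/-- The first cohomology `H¹_r(G; A) = Z¹_r(G; A) / B¹_r(G; A)` for the right action of `G` on `A`. -/
abbrev RightH1 : Type u :=
  rightCocycles (K := K) u ⧸ (rightCoboundaries (K := K) u).submoduleOf (rightCocycles u)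

variable (K) in
/-- The class of a right cocycle. -/
def rightH1Mk : rightCocycles (K := K) u →ₗ[K] RightH1 K u := Submodule.mkQ _

variable (K) in
/-- The left action of `G` on `Z¹_r(G; A)`, namely `(g D)(h) = g D(h)`. -/
def leftMul (g : G) : rightCocycles (K := K) u →ₗ[K] rightCocycles (K := K) u where
  toFun D := ⟨fun h => u g * D.1 h, fun h k => by
    change u g * D.1 (h * k) = u g * D.1 h * u k + u g * D.1 k
    rw [D.2 h k, mul_add, mul_assoc]⟩
  map_add' D E := Subtype.ext <| funext fun h => mul_add _ _ _
  map_smul' r D := Subtype.ext <| funext fun h => mul_smul_comm _ _ _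

theorem leftMul_coboundary (g : G) :
    (rightCoboundaries (K := K) u).submoduleOf (rightCocycles u) ≤
      ((rightCoboundaries (K := K) u).submoduleOf (rightCocycles u)).comap (leftMul K u g) := by
  rintro D ⟨c, hc⟩
  refine ⟨u g * c, fun h => ?_⟩
  change u g * D.1 h = _
  have hc' : D.1 h = c * u h - c := hc h
  rw [hc', mul_sub, mul_assoc]

variable (K) in
/-- The left action of `G` on `H¹_r(G; A)`, induced by `(g D)(h) = g D(h)`. -/
def rightH1Action : Representation K G (RightH1 K u) where
  toFun g := Submodule.mapQ _ _ (leftMul K u g) (leftMul_coboundary u g)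
  map_one' := by
    refine Submodule.linearMap_qext _ (LinearMap.ext fun D => ?_)
    refine congrArg (rightH1Mk K u) (Subtype.ext <| funext fun h => ?_)
    change u 1 * D.1 h = D.1 h
    rw [map_one, one_mul]
  map_mul' g g' := by
    refine Submodule.linearMap_qext _ (LinearMap.ext fun D => ?_)
    refine congrArg (rightH1Mk K u) (Subtype.ext <| funext fun h => ?_)
    change u (g * g') * D.1 h = u g * (u g' * D.1 h)
    rw [map_mul, mul_assoc]

end rightH1

section fox
variable (K G : Type u) [CommRing K] [Group G]

/-- The group ring `K[G]`. -/
abbrev GrpAlg : Type u := MonoidAlgebra K G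

/-- The augmentation `K[G] → K`. -/
def aug : GrpAlg K G →ₐ[K] K := MonoidAlgebra.lift K K G 1

theorem aug_of (g : G) : aug K G (MonoidAlgebra.of K G g) = 1 := by simp [aug]

/-- The Fox pairings `K[G] × K[G] → K[G]`. -/
def foxPairings : Submodule K (GrpAlg K G →ₗ[K] GrpAlg K G →ₗ[K] GrpAlg K G) where
  carrier := {η |
    (∀ a₁ a₂ b, η (a₁ * a₂) b = aug K G a₂ • η a₁ b + a₁ * η a₂ b) ∧
    ∀ a b₁ b₂, η a (b₁ * b₂) = η a b₁ * b₂ + aug K G b₁ • η a b₂}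
  zero_mem' := by simp
  add_mem' := by
    rintro η θ ⟨h₁, h₂⟩ ⟨k₁, k₂⟩
    refine ⟨fun a₁ a₂ b => ?_, fun a b₁ b₂ => ?_⟩
    · simp only [LinearMap.add_apply, h₁, k₁, smul_add, mul_add]; abel
    · simp only [LinearMap.add_apply, h₂, k₂, smul_add, add_mul]; abel
  smul_mem' := by
    rintro c η ⟨h₁, h₂⟩
    refine ⟨fun a₁ a₂ b => ?_, fun a b₁ b₂ => ?_⟩
    · simp only [LinearMap.smul_apply, h₁, smul_add, mul_smul_comm, smul_comm c]
    · simp only [LinearMap.smul_apply, h₂, smul_add, smul_mul_assoc, smul_comm c]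

/-- The left `K[G]`-module `H¹(G; K[G])`, formed with the right action on `K[G]`. -/
abbrev rightH1Rep : Rep.{u} K G := Rep.of (rightH1Action K (MonoidAlgebra.of K G))

variable {K G}

/-- The 1-cochain `g ↦ [η(g, -)]` of `G` in `H¹(G; K[G])` defined by a Fox pairing `η`. -/
def foxCochain (η : foxPairings K G) : Cochain (rightH1Rep K G) 1 := fun g =>
  rightH1Mk K (MonoidAlgebra.of K G)
    ⟨fun h => η.1 (MonoidAlgebra.of K G (g 0)) (MonoidAlgebra.of K G h), fun h k => by
      change η.1 _ (MonoidAlgebra.of K G (h * k)) = _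
      rw [map_mul, η.2.2, aug_of, one_smul]⟩

theorem foxCochain_mem (η : foxPairings K G) :
    foxCochain η ∈ cocycles (coboundary (rightH1Rep K G)) 1 := by
  rw [LinearMap.mem_ker]
  funext g
  refine (inhomogeneousCochains.d_hom_apply (rightH1Rep K G) 1 (foxCochain η) g).trans ?_
  rw [Fin.sum_univ_two]
  have key : (rightH1Rep K G).ρ (g 0) (foxCochain η fun _ => g 1) +
      foxCochain η (fun _ => g 0) = foxCochain η (fun _ => g 0 * g 1) := by
    refine congrArg (rightH1Mk K (MonoidAlgebra.of K G)) (Subtype.ext <| funext fun h => ?_)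
    change MonoidAlgebra.of K G (g 0) *
        η.1 (MonoidAlgebra.of K G (g 1)) (MonoidAlgebra.of K G h) +
      η.1 (MonoidAlgebra.of K G (g 0)) (MonoidAlgebra.of K G h) =
        η.1 (MonoidAlgebra.of K G (g 0 * g 1)) (MonoidAlgebra.of K G h)
    rw [map_mul, η.2.1, aug_of, one_smul, add_comm]
  have c0 : Fin.contractNth (0 : Fin 2) (· * ·) g = fun _ => g 0 * g 1 := by
    funext i; fin_cases i; rfl
  have c1 : Fin.contractNth (1 : Fin 2) (· * ·) g = fun _ => g 0 := by
    funext i; fin_cases i; rfl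
  have c2 : (fun i : Fin 1 => g i.succ) = fun _ => g 1 := by
    funext i; fin_cases i; rfl
  rw [c0, c1, c2, ← key]
  simp

/-- The class in `H¹(G; H¹(G; K[G]))` represented by a Fox pairing. -/
def foxClass (η : foxPairings K G) : GrpCohomology (rightH1Rep K G) 1 :=
  Submodule.Quotient.mk ⟨foxCochain η, foxCochain_mem η⟩

/-- Left derivations of `K[G]`. -/
def IsLeftDerivation (D : GrpAlg K G →ₗ[K] GrpAlg K G) : Prop :=
  ∀ a b, D (a * b) = aug K G b • D a + a * D b

/-- Right derivations of `K[G]`. -/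
def IsRightDerivation (D : GrpAlg K G →ₗ[K] GrpAlg K G) : Prop :=
  ∀ a b, D (a * b) = D a * b + aug K G a • D b

/-- `ν` is a balanced bilinear map which is left linear in the first and right linear in the second
argument, i.e. a bimodule homomorphism `K[G] ⊗_{K[G]} K[G] → K[G]`. -/
def IsBimoduleMap (ν : GrpAlg K G →ₗ[K] GrpAlg K G →ₗ[K] GrpAlg K G) : Prop :=
  ∀ c x y, ν (c * x) y = c * ν x y ∧ ν (x * c) y = ν x (c * y) ∧ ν x (y * c) = ν x y * c

/-- A Fox pairing `η` represents the class `c ∈ H¹(G, S; H¹(G; K[G]))`: the pair `([η], a)` is a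
relative cocycle with class `c` for some family `a` of elements `a_k ∈ H¹(G; K[G])`, `k ≤ m`. -/
def RepresentsRel {m : ℕ} (S : Fin m → Subgroup G) (η : foxPairings K G)
    (c : RelCohomology S (rightH1Rep K G) 1) : Prop :=
  ∃ z : relCocycles S (rightH1Rep K G) 1,
    z.1.1 = foxCochain η ∧ relClass S (rightH1Rep K G) 1 z = c

/-- `η` is a finite sum of Fox pairings of the form `(a, b) ↦ ν(D_l(a), D_r(b))`. -/
def IsSumOfDerivationPairings (η : foxPairings K G) : Prop :=
  ∃ (r : ℕ) (ν : Fin r → GrpAlg K G →ₗ[K] GrpAlg K G →ₗ[K] GrpAlg K G)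
    (Dl Dr : Fin r → GrpAlg K G →ₗ[K] GrpAlg K G),
    (∀ i, IsBimoduleMap (ν i) ∧ IsLeftDerivation (Dl i) ∧ IsRightDerivation (Dr i)) ∧
    ∀ a b, η.1 a b = ∑ i, ν i (Dl i a) (Dr i b)

end fox

end PDPair
end

/-! Everything rests on `G` having cohomological dimension at most one. Because `m ≥ 1`, already a
single `S_k` contributes all of `M` in degree 0, so `H_0(G, S; M) = 0`; capping with `e` then gives
`H²(G; M) = 0` for every `M` (`IsPDPair.subsingleton_cohomology_two`). Hence 1-cocycles lift along
equivariant maps whose range contains their values (`exists_lift_cocycle`).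

Existence: a 1-cocycle `G → B` lifts along the projection `Z¹_r → B`, and a 1-cocycle `G → Z¹_r`,
extended bilinearly, is a Fox pairing. So every 1-cocycle is equal to some `[η]`, not merely
cohomologous to it (`IsPDPair.exists_foxCochain_eq`), and this serves all three assertions at once.

Derivation type: the same lifting, applied to `g ↦ g - 1` and the free cover of the augmentation
ideal on the elements `j - 1`, gives left derivations `d_j` with `g - 1 = ∑ d_j(g)(j - 1)`. Finitely
many `j` suffice (`IsPDPair.exists_support_subset`): `e ∩ d` is a finite chain, so a truncation of
`d` to finitely many coordinates has the same cap product, and injectivity of `e ∩ -` makes the two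
cohomologous; the correcting coboundary also has finite support. As `η(1, b) = 0`, it follows that
`η(g, b) = η(g - 1, b) = ∑ d_j(g) η(j, b)`, a finite sum of pairings of derivation type. -/

noncomputable section
namespace PDPair
open Finsupp

/-! ### Low-degree cocycles and the lifting of 1-cocycles when `H²` vanishes -/

section lifting
variable {K G : Type u} [CommRing K] [Group G]

/-- An equivariant map commutes with the coboundaries. -/
theorem coboundary_comp {A B : Rep.{u} K G} (p : A →ₗ[K] B)
    (hp : ∀ g x, p (A.ρ g x) = B.ρ g (p x)) (n : ℕ) (f : Cochain A n) :
    coboundary B n (fun g => p (f g)) = fun g => p (coboundary A n f g) := by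
  funext g
  have e1 := inhomogeneousCochains.d_hom_apply A n f g
  have e2 := inhomogeneousCochains.d_hom_apply B n (fun g => p (f g)) g
  refine e2.trans (Eq.trans ?_ (congrArg p e1).symm)
  simp [hp]

theorem coboundary_coboundary (A : Rep.{u} K G) (n : ℕ) (f : Cochain A n) :
    coboundary A (n + 1) (coboundary A n f) = 0 :=
  congrArg (fun φ => φ.hom f) (groupCohomology.inhomogeneousCochains.d_comp_d n A)

theorem coboundary_one_apply (A : Rep.{u} K G) (f : G → A) (g h : G) :
    coboundary A 1 (fun x => f (x 0)) ![g, h] = A.ρ g (f h) - f (g * h) + f g := by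
  refine (inhomogeneousCochains.d_hom_apply A 1 (fun x => f (x 0)) ![g, h]).trans ?_
  rw [Fin.sum_univ_two]
  simp [Fin.contractNth]
  abel

theorem coboundary_zero_apply (A : Rep.{u} K G) (f : Cochain A 0) (g : Fin 1 → G) :
    coboundary A 0 f g = A.ρ (g 0) (f ![]) - f ![] := by
  refine (inhomogeneousCochains.d_hom_apply A 0 f g).trans ?_
  simp only [Subsingleton.elim _ (![] : Fin 0 → G)]
  simp [sub_eq_add_neg]

theorem mem_cocycles_one (A : Rep.{u} K G) (f : G → A) :
    (fun x : Fin 1 → G => f (x 0)) ∈ cocycles (coboundary A) 1 ↔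
      ∀ g h, f (g * h) = A.ρ g (f h) + f g := by
  rw [LinearMap.mem_ker]
  constructor
  · intro hf g h
    have := (coboundary_one_apply A f g h).symm.trans (congrFun hf ![g, h])
    rw [Pi.zero_apply, sub_add_eq_add_sub] at this
    exact (sub_eq_zero.1 this).symm
  · intro hf
    funext x
    obtain ⟨g, h, rfl⟩ : ∃ g h, x = ![g, h] := ⟨x 0, x 1, by ext i; fin_cases i <;> rfl⟩
    rw [coboundary_one_apply, hf]
    simp

theorem exists_cochain_one_eq (A : Rep.{u} K G) (f : Cochain A 1) :
    ∃ f' : G → A, f = fun x => f' (x 0) := by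
  refine ⟨fun g => f fun _ => g, funext fun x => congrArg f (funext fun i => ?_)⟩
  rw [Subsingleton.elim i 0]

/-- The kernel of an equivariant map, as a module. -/
def kerRep {A B : Rep.{u} K G} (p : A →ₗ[K] B)
    (hp : ∀ g x, p (A.ρ g x) = B.ρ g (p x)) : Rep.{u} K G :=
  Rep.of (A.ρ.subrepresentation (LinearMap.ker p) fun g x hx => by
    rw [Submodule.mem_comap, LinearMap.mem_ker, hp, LinearMap.mem_ker.1 hx, map_zero])

/-- If the second cohomology vanishes, then a 1-cocycle with values in the range of an equivariant
map lifts along that map. -/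
theorem exists_lift_cocycle
    (h2 : ∀ M : Rep.{u} K G, Subsingleton (Cohomology (coboundary M) 2))
    {A B : Rep.{u} K G} (p : A →ₗ[K] B) (hp : ∀ g x, p (A.ρ g x) = B.ρ g (p x))
    (f : Cochain B 1) (hf : f ∈ cocycles (coboundary B) 1) (hr : ∀ g, ∃ a, p a = f g) :
    ∃ f' ∈ cocycles (coboundary A) 1, ∀ g, p (f' g) = f g := by
  choose s hs using hr
  -- The pointwise lift `s` need not be a cocycle, but `p` sends its defect `δs` to `δf = 0`, so
  -- `δs` is a 2-cocycle with values in the kernel.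
  let z : Cochain (kerRep p hp) 2 := fun g => ⟨coboundary A 1 s g, by
    rw [LinearMap.mem_ker, ← congrFun (coboundary_comp p hp 1 s) g, funext hs]
    exact congrFun hf g⟩
  let i : kerRep p hp →ₗ[K] A := (LinearMap.ker p).subtype
  have hi : ∀ g x, i ((kerRep p hp).ρ g x) = A.ρ g (i x) := fun g x => rfl
  have hz : z ∈ cocycles (coboundary (kerRep p hp)) 2 := by
    rw [LinearMap.mem_ker]
    funext g
    refine Subtype.ext ?_
    refine (congrFun (coboundary_comp i hi 2 z) g).symm.trans ?_
    exact congrFun (coboundary_coboundary A 1 s) g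
  have hb := (Submodule.Quotient.mk_eq_zero _).1
    ((h2 (kerRep p hp)).elim (Submodule.Quotient.mk ⟨z, hz⟩) 0)
  obtain ⟨n, hn⟩ : ∃ n, coboundary (kerRep p hp) 1 n = z := hb
  -- Subtracting a kernel-valued primitive of `δs` removes the defect without changing the image
  -- under `p`.
  refine ⟨s - fun g => i (n g), ?_, fun g => ?_⟩
  · rw [LinearMap.mem_ker, map_sub, coboundary_comp i hi, hn]
    exact sub_self _
  · have : p (i (n g)) = 0 := (n g).2
    rw [Pi.sub_apply, map_sub, this, hs, sub_zero]

end lifting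

/-! ### Vanishing of `H_0(G, S; M)` and of `H²(G; M)` -/

section vanishing
variable {K G : Type u} [CommRing K] [Group G] {m : ℕ} (S : Fin m → Subgroup G)

/-- Both `C_0(S_k; M)` and `C_0(G; M)` are copies of `M` on the empty tuple, and the inclusion
identifies them; one index `k` is therefore enough. -/
theorem relBoundary_zero_surjective (hm : 0 < m) (M : Rep.{u} K G) :
    Function.Surjective (relBoundary S M 0) := by
  rintro ⟨x, y⟩
  let k : Fin m := ⟨0, hm⟩
  refine ⟨(0, (shiftEquiv K (FamChain S M) 0).symm (Pi.single k (single ![] (x ![])))), ?_⟩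
  -- The second component of a relative 0-chain lies in `PUnit`.
  refine Prod.ext ?_ rfl
  change boundary M 0 0 + push S M 0 (Pi.single k (single ![] (x ![]))) = x
  rw [map_zero, zero_add, push, LinearMap.sum_apply, Finset.sum_eq_single k]
  · simp only [LinearMap.comp_apply, LinearMap.proj_apply, Pi.single_eq_same,
      Finsupp.lmapDomain_apply, Finsupp.mapDomain_single]
    refine Finsupp.ext fun g => ?_
    rw [Subsingleton.elim (fun i => ((![] : Fin 0 → S k) i : G)) g,
      Subsingleton.elim (![] : Fin 0 → G) g, Finsupp.single_eq_same]
  · intro j _ hj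
    simp [Pi.single_eq_of_ne hj]
  · simp

/-- A duality pair with a nonempty family of subgroups has cohomological dimension at most 1. -/
theorem IsPDPair.subsingleton_cohomology_two {S : Fin m → Subgroup G} (hm : 0 < m)
    (hPD : IsPDPair (K := K) S 2) (M : Rep.{u} K G) :
    Subsingleton (Cohomology (coboundary M) 2) := by
  obtain ⟨e, he⟩ := hPD
  -- The isomorphism `H²(G; M) ≅ H_0(G, S; M)`.
  have hb := ((he M).1 2 0 rfl).1
  have : Subsingleton (Homology (relBoundary S M) 0) := by
    refine Submodule.Quotient.subsingleton_iff.2 (eq_top_iff.2 fun x _ => ?_)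
    exact relBoundary_zero_surjective S hm M x.1
  exact hb.1.subsingleton

end vanishing

/-! ### Finiteness: cap products only see finitely many coordinates -/

section finiteness
variable {K G : Type u} [CommRing K] [Group G]

/-- An equivariant map commutes with cap products. -/
theorem cap_comp {A B : Rep.{u} K G} (p : A →ₗ[K] B)
    (hp : ∀ g x, p (A.ρ g x) = B.ρ g (p x)) {i j n : ℕ} (h : i + j = n)
    (x : (Fin n → G) →₀ K) (f : Cochain A i) :
    cap B h x (fun g => p (f g)) = Finsupp.mapRange.linearMap p (cap A h x f) := by
  induction x using Finsupp.induction_linear with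
  | zero => simp [cap]
  | add x y hx hy => rw [cap_add, cap_add, map_add, hx, hy]
  | single g c => simp [cap_single, hp]

/-- A family of equivariant endomorphisms, indexed by finite sets, that is eventually the identity
on each element is eventually the identity on each chain. -/
theorem exists_map_chain_eq {H J : Type u} {n : ℕ} {V : Type u} [AddCommGroup V] [Module K V]
    (π : Finset J → V →ₗ[K] V) (hπ : ∀ v, ∃ T₀, ∀ T, T₀ ⊆ T → π T v = v)
    (x : (Fin n → H) →₀ V) :
    ∃ T₀ : Finset J, ∀ T, T₀ ⊆ T → Finsupp.mapRange.linearMap (π T) x = x := by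
  classical
  choose t ht using hπ
  -- A chain has finitely many coefficients, so the union of their thresholds is finite.
  refine ⟨x.support.biUnion fun g => t (x g), fun T hT => Finsupp.ext fun g => ?_⟩
  rw [Finsupp.mapRange.linearMap_apply, Finsupp.mapRange_apply]
  by_cases hg : x g = 0
  · rw [hg, map_zero]
  · exact ht _ T ((Finset.subset_biUnion_of_mem (fun g => t (x g))
      (Finsupp.mem_support_iff.2 hg)).trans hT)

/-- The cochain `f` may take infinitely many values, but its cap product with a fixed chain is a
finite chain and commutes with `π T`. The form "for all larger `T`" lets several such thresholds be
combined. -/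
theorem exists_cap_map_eq {H J : Type u} [Group H] (N : Rep.{u} K H) (π : Finset J → N →ₗ[K] N)
    (hπ : ∀ v, ∃ T₀, ∀ T, T₀ ⊆ T → π T v = v)
    (hπρ : ∀ T g v, π T (N.ρ g v) = N.ρ g (π T v)) {i j n : ℕ} (h : i + j = n)
    (x : (Fin n → H) →₀ K) (f : Cochain N i) :
    ∃ T₀ : Finset J, ∀ T, T₀ ⊆ T → cap N h x (fun g => π T (f g)) = cap N h x f := by
  obtain ⟨T₀, hT₀⟩ := exists_map_chain_eq π hπ (cap N h x f)
  exact ⟨T₀, fun T hT => (cap_comp (π T) (hπρ T) h x f).trans (hT₀ T hT)⟩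

theorem relCap_congr {m : ℕ} (S : Fin m → Subgroup G) (M : Rep.{u} K G) {p q n : ℕ}
    (h : p + q = n) (e : RelChain S (trivialRep K G) n) {f f' : Cochain M p}
    (h₁ : cap M h e.1 f = cap M h e.1 f')
    (h₂ : capShift S M h e.2 (restrict S M p f) = capShift S M h e.2 (restrict S M p f')) :
    relCap S M h e f = relCap S M h e f' := by
  refine Prod.ext h₁ ?_
  change ((-1 : K) ^ p • capShift S M h e.2) (restrict S M p f) =
    ((-1 : K) ^ p • capShift S M h e.2) (restrict S M p f')
  rw [LinearMap.smul_apply, LinearMap.smul_apply, h₂]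

theorem sub_mem_coboundaries_of_relCap_eq {m : ℕ} (S : Fin m → Subgroup G) (M : Rep.{u} K G)
    {p q n : ℕ} (h : p + q = n) (e : cycles (relBoundary S (trivialRep K G)) n)
    (hinj : Function.Injective (capAbs S M h e)) {f f' : Cochain M p}
    (hf : f ∈ cocycles (coboundary M) p) (hf' : f' ∈ cocycles (coboundary M) p)
    (heq : relCap S M h e.1 f = relCap S M h e.1 f') :
    f - f' ∈ coboundaries (coboundary M) p := by
  have hclass := @hinj (Submodule.Quotient.mk ⟨f, hf⟩) (Submodule.Quotient.mk ⟨f', hf'⟩)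
    (congrArg Submodule.Quotient.mk (Subtype.ext heq))
  have hmem := (Submodule.Quotient.eq _).1 hclass
  exact hmem

theorem exists_famCap_map_eq {m : ℕ} (S : Fin m → Subgroup G) {J : Type u} (M : Rep.{u} K G)
    (π : Finset J → M →ₗ[K] M) (hπ : ∀ v, ∃ T₀, ∀ T, T₀ ⊆ T → π T v = v)
    (hπρ : ∀ T g v, π T (M.ρ g v) = M.ρ g (π T v)) {p q n : ℕ} (h : p + q = n)
    (y : FamChain S (trivialRep K G) n) (f : Cochain M p) :
    ∃ T₀ : Finset J, ∀ T, T₀ ⊆ T → famCap S M h y (restrict S M p fun g => π T (f g)) =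
      famCap S M h y (restrict S M p f) := by
  classical
  choose T hT using fun k => exists_cap_map_eq (resRep M (S k)) π hπ (fun T g => hπρ T g)
    h (y k) (restrict S M p f k)
  exact ⟨Finset.univ.biUnion T, fun T' hT' => funext fun k => hT k T'
    ((Finset.subset_biUnion_of_mem T (Finset.mem_univ k)).trans hT')⟩

/-- The component in `G` and the components in the finitely many `S_k` each have a threshold; their
union works for the whole relative chain. -/
theorem exists_relCap_map_eq {m : ℕ} (S : Fin m → Subgroup G) {J : Type u} (M : Rep.{u} K G)
    (π : Finset J → M →ₗ[K] M) (hπ : ∀ v, ∃ T₀, ∀ T, T₀ ⊆ T → π T v = v)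
    (hπρ : ∀ T g v, π T (M.ρ g v) = M.ρ g (π T v)) {p q n : ℕ} (h : p + q = n)
    (e : RelChain S (trivialRep K G) n) (f : Cochain M p) :
    ∃ T : Finset J, relCap S M h e (fun g => π T (f g)) = relCap S M h e f := by
  classical
  obtain ⟨T₁, hT₁⟩ := exists_cap_map_eq M π hπ hπρ h e.1 f
  cases q with
  -- For `q = 0` the component in the `S_k` lies in `PUnit`, so only the component in `G` matters.
  | zero => exact ⟨T₁, relCap_congr S M h e (hT₁ T₁ subset_rfl) rfl⟩
  | succ q =>
    obtain ⟨n, rfl⟩ : ∃ n', n = n' + 1 := ⟨p + q, by omega⟩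
    obtain ⟨T₂, hT₂⟩ := exists_famCap_map_eq S M π hπ hπρ (by omega : p + q = n)
      (shiftEquiv K (FamChain S (trivialRep K G)) n e.2) f
    exact ⟨T₁ ∪ T₂, relCap_congr S M h e (hT₁ _ Finset.subset_union_left)
      (congrArg (shiftEquiv K (FamChain S M) q).symm (hT₂ _ Finset.subset_union_right))⟩

/-- If the cap product with `e` is injective, the class of a cocycle is fixed by some member of a
family of equivariant endomorphisms that is eventually the identity on each coefficient. -/
theorem exists_sub_map_mem_coboundaries {m : ℕ} (S : Fin m → Subgroup G) {J : Type u}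
    (M : Rep.{u} K G) (π : Finset J → M →ₗ[K] M)
    (hπ : ∀ v, ∃ T₀, ∀ T, T₀ ⊆ T → π T v = v)
    (hπρ : ∀ T g v, π T (M.ρ g v) = M.ρ g (π T v)) {p q n : ℕ} (h : p + q = n)
    (e : cycles (relBoundary S (trivialRep K G)) n)
    (hinj : Function.Injective (capAbs S M h e)) (d : Cochain M p)
    (hd : d ∈ cocycles (coboundary M) p) :
    ∃ T : Finset J, (d - fun g => π T (d g)) ∈ coboundaries (coboundary M) p := by
  obtain ⟨T, hcap⟩ := exists_relCap_map_eq S M π hπ hπρ h e.1 d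
  have hd' : (fun g => π T (d g)) ∈ cocycles (coboundary M) p := by
    rw [LinearMap.mem_ker, coboundary_comp _ (hπρ T), LinearMap.mem_ker.1 hd]
    exact funext fun g => map_zero _
  exact ⟨T, sub_mem_coboundaries_of_relCap_eq S M h e hinj hd hd' hcap.symm⟩

theorem exists_of_mem_coboundaries_one (M : Rep.{u} K G) {f : Cochain M 1}
    (hf : f ∈ coboundaries (coboundary M) 1) : ∃ c : M, ∀ g, f g = M.ρ (g 0) c - c := by
  obtain ⟨c, rfl⟩ := hf
  exact ⟨c ![], coboundary_zero_apply M c⟩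

/-- The middle degree `1 + 1 = 2` of the duality, with the coboundary relating `d` and `π T ∘ d`
made explicit, so that its generator `c` can be absorbed into a larger finite set. -/
theorem IsPDPair.exists_map_add_eq {m : ℕ} {S : Fin m → Subgroup G}
    (hPD : IsPDPair (K := K) S 2) {J : Type u} (M : Rep.{u} K G) (π : Finset J → M →ₗ[K] M)
    (hπ : ∀ v, ∃ T₀, ∀ T, T₀ ⊆ T → π T v = v)
    (hπρ : ∀ T g v, π T (M.ρ g v) = M.ρ g (π T v))
    (d : Cochain M 1) (hd : d ∈ cocycles (coboundary M) 1) :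
    ∃ (T : Finset J) (c : M), ∀ g, d g = π T (d g) + (M.ρ (g 0) c - c) := by
  obtain ⟨e, he⟩ := hPD
  obtain ⟨T, hT⟩ := exists_sub_map_mem_coboundaries S M π hπ hπρ (rfl : 1 + 1 = 2) e
    ((he M).1 1 1 rfl).1.1 d hd
  obtain ⟨c, hc⟩ := exists_of_mem_coboundaries_one M hT
  exact ⟨T, c, fun g => sub_eq_iff_eq_add'.1 (hc g)⟩

/-! ### Free modules and truncation to finitely many coordinates -/

/-- The left regular module `K[G]`. -/
def regularRep (K G : Type u) [CommRing K] [Group G] : Rep.{u} K G :=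
  Rep.of (X := GrpAlg K G)
    ((Algebra.lmul K (GrpAlg K G)).toMonoidHom.comp (MonoidAlgebra.of K G))

/-- The free `K[G]`-module with basis `J`. -/
def freeRep (K G J : Type u) [CommRing K] [Group G] : Rep.{u} K G :=
  Rep.of (X := J →₀ GrpAlg K G)
    { toFun g := Finsupp.mapRange.linearMap (LinearMap.mulLeft K (MonoidAlgebra.of K G g))
      map_one' := by
        refine LinearMap.ext fun x => Finsupp.ext fun j => ?_
        change MonoidAlgebra.of K G 1 * x j = x j
        rw [map_one, one_mul]
      map_mul' g h := by
        refine LinearMap.ext fun x => Finsupp.ext fun j => ?_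
        change MonoidAlgebra.of K G (g * h) * x j =
          MonoidAlgebra.of K G g * (MonoidAlgebra.of K G h * x j)
        rw [map_mul, mul_assoc] }

/-- The coordinates of an element of a free module. -/
def coords {J : Type u} : freeRep K G J ≃ₗ[K] (J →₀ GrpAlg K G) := LinearEquiv.refl K _

theorem coords_smul {J : Type u} (g : G) (x : freeRep K G J) (j : J) :
    coords ((freeRep K G J).ρ g x) j = MonoidAlgebra.of K G g * coords x j := rfl

open Classical in
/-- The projection of a free module to the coordinates in a finite set. -/
def truncate {J : Type u} (T : Finset J) : freeRep K G J →ₗ[K] freeRep K G J :=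
  coords.symm.toLinearMap ∘ₗ (Finsupp.supported (GrpAlg K G) K (T : Set J)).subtype ∘ₗ
    Finsupp.restrictDom (GrpAlg K G) K (T : Set J) ∘ₗ coords.toLinearMap

/-- Expresses a bound on the support as a fixed-point equation, which passes through sums and the
action of `G`. -/
theorem truncate_eq_self {J : Type u} {T : Finset J} {x : freeRep K G J} :
    truncate T x = x ↔ (coords x).support ⊆ T := by
  classical
  refine Iff.trans (b := (coords x).filter (· ∈ (T : Set J)) = coords x) Iff.rfl ?_
  rw [Finsupp.filter_eq_self_iff]
  simp [Finset.subset_iff]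

theorem coords_truncate_support {J : Type u} (T : Finset J) (x : freeRep K G J) :
    (coords (truncate T x)).support ⊆ T := by
  classical
  change ((coords x).filter (· ∈ (T : Set J))).support ⊆ T
  rw [Finsupp.support_filter]
  simp [Finset.subset_iff]

theorem truncate_smul {J : Type u} (T : Finset J) (g : G) (x : freeRep K G J) :
    truncate T ((freeRep K G J).ρ g x) = (freeRep K G J).ρ g (truncate T x) := by
  classical
  refine coords.injective (Finsupp.ext fun j => ?_)
  rw [coords_smul]
  change (coords ((freeRep K G J).ρ g x)).filter (· ∈ (T : Set J)) j =
    _ * (coords x).filter (· ∈ (T : Set J)) j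
  simp only [Finsupp.filter_apply, coords_smul]
  split_ifs <;> simp

/-- Over a duality pair, a 1-cocycle with values in a free module involves only finitely many
coordinates. -/
theorem IsPDPair.exists_support_subset {m : ℕ} {S : Fin m → Subgroup G}
    (hPD : IsPDPair (K := K) S 2) {J : Type u} (d : Cochain (freeRep K G J) 1)
    (hd : d ∈ cocycles (coboundary (freeRep K G J)) 1) :
    ∃ T : Finset J, ∀ g, (coords (d g)).support ⊆ T := by
  classical
  obtain ⟨T, c, hc⟩ := hPD.exists_map_add_eq (freeRep K G J) truncate
    (fun v => ⟨_, fun T hT => truncate_eq_self.2 hT⟩) truncate_smul d hd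
  -- In `d g = truncate T (d g) + (g c - c)` the first term is supported in `T`, and `g c` involves
  -- no coordinate outside the support of `c`.
  refine ⟨T ∪ (coords c).support, fun g => ?_⟩
  rw [← truncate_eq_self, hc g, map_add, map_sub, truncate_smul,
    truncate_eq_self.2 ((coords_truncate_support T (d g)).trans Finset.subset_union_left),
    truncate_eq_self.2 (Finset.subset_union_right : _ ⊆ T ∪ (coords c).support)]

end finiteness

/-! ### A finite dual basis of the augmentation ideal -/

section generation
variable {K G : Type u} [CommRing K] [Group G]

/-- The equivariant map from the free module on `G` to `K[G]` sending the basis element of `j` to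
`j - 1`; its image is the augmentation ideal. -/
def augIdealCover (K G : Type u) [CommRing K] [Group G] : freeRep K G G →ₗ[K] regularRep K G :=
  Finsupp.lsum K (fun j : G => LinearMap.mulRight K (MonoidAlgebra.of K G j - 1)) ∘ₗ
    coords.toLinearMap

theorem augIdealCover_apply (x : freeRep K G G) :
    augIdealCover K G x = (coords x).sum fun j a => a * (MonoidAlgebra.of K G j - 1) := rfl

theorem augIdealCover_smul (g : G) (x : freeRep K G G) :
    augIdealCover K G ((freeRep K G G).ρ g x) =
      (regularRep K G).ρ g (augIdealCover K G x) := by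
  change _ = MonoidAlgebra.of K G g * ((coords x).sum fun j a => a * (MonoidAlgebra.of K G j - 1))
  rw [augIdealCover_apply, Finsupp.mul_sum]
  change (Finsupp.mapRange (fun a => MonoidAlgebra.of K G g * a) (mul_zero _) (coords x)).sum _ = _
  rw [Finsupp.sum_mapRange_index (by simp)]
  simp only [mul_assoc]

/-- Over a duality pair with a nonempty family of subgroups, the augmentation ideal is finitely
generated and projective: it has a finite dual basis. -/
theorem IsPDPair.exists_dual_basis {m : ℕ} {S : Fin m → Subgroup G} (hm : 0 < m)
    (hPD : IsPDPair (K := K) S 2) :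
    ∃ (T : Finset G) (d : G → G → GrpAlg K G),
      (∀ j g h, d j (g * h) = d j g + MonoidAlgebra.of K G g * d j h) ∧
      ∀ g, MonoidAlgebra.of K G g - 1 = ∑ j ∈ T, d j g * (MonoidAlgebra.of K G j - 1) := by
  have hf : (fun x : Fin 1 → G => (MonoidAlgebra.of K G (x 0) - 1 : GrpAlg K G)) ∈
      cocycles (coboundary (regularRep K G)) 1 := by
    refine (mem_cocycles_one (regularRep K G)
      fun g => (MonoidAlgebra.of K G g - 1 : GrpAlg K G)).2 fun g h => ?_
    change MonoidAlgebra.of K G (g * h) - 1 =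
      MonoidAlgebra.of K G g * (MonoidAlgebra.of K G h - 1) + (MonoidAlgebra.of K G g - 1)
    rw [map_mul, mul_sub, mul_one]; abel
  -- The cover is not onto `K[G]`, but it reaches each `g - 1`, as the image of the basis element of
  -- `g`. The coordinates of the lifted cocycle are the left derivations sought.
  obtain ⟨d, hd, hdf⟩ := exists_lift_cocycle (hPD.subsingleton_cohomology_two hm)
    (augIdealCover K G) augIdealCover_smul _ hf fun x =>
      ⟨coords.symm (single (x 0) 1), by
        rw [augIdealCover_apply, LinearEquiv.apply_symm_apply,
          Finsupp.sum_single_index (zero_mul _), one_mul]⟩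
  obtain ⟨T, hT⟩ := hPD.exists_support_subset d hd
  obtain ⟨d, rfl⟩ := exists_cochain_one_eq _ d
  refine ⟨T, fun j g => coords (d g) j, fun j g h => ?_, fun g => ?_⟩
  · beta_reduce
    rw [(mem_cocycles_one (freeRep K G G) d).1 hd g h, map_add, Finsupp.add_apply, coords_smul, add_comm]
  · rw [← hdf fun _ => g, augIdealCover_apply]
    exact Finsupp.sum_of_support_subset _ (hT fun _ => g) _ (by simp)

end generation

/-! ### Derivations and Fox pairings from their values on `G` -/

section fox
variable {K G : Type u} [CommRing K] [Group G]

/-- Linear maps on the group ring are determined by their values on `G`. -/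
theorem linearMap_ext_of {N : Type u} [AddCommGroup N] [Module K N] {f f' : GrpAlg K G →ₗ[K] N}
    (h : ∀ g, f (MonoidAlgebra.of K G g) = f' (MonoidAlgebra.of K G g)) : f = f' :=
  (MonoidAlgebra.basis G K).ext h

/-- The linear extension of a map on `G` to the group ring. -/
def linExt {N : Type u} [AddCommGroup N] [Module K N] (D : G → N) : GrpAlg K G →ₗ[K] N :=
  (MonoidAlgebra.basis G K).constr K D

theorem linExt_of {N : Type u} [AddCommGroup N] [Module K N] (D : G → N) (g : G) :
    linExt (K := K) D (MonoidAlgebra.of K G g) = D g :=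
  (MonoidAlgebra.basis G K).constr_basis K D g

/-- Both sides of the derivation law are bilinear in `(a, b)`, so it may be checked on `G × G`,
where the augmentation is 1. -/
theorem isLeftDerivation_of_group {D : GrpAlg K G →ₗ[K] GrpAlg K G}
    (h : ∀ g g' : G, D (MonoidAlgebra.of K G (g * g')) =
      D (MonoidAlgebra.of K G g) + MonoidAlgebra.of K G g * D (MonoidAlgebra.of K G g')) :
    IsLeftDerivation D := by
  intro a b
  have key : (LinearMap.mul K (GrpAlg K G)).compr₂ D =
      (LinearMap.lsmul K (GrpAlg K G) ∘ₗ (aug K G).toLinearMap).flip ∘ₗ D +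
        (LinearMap.mul K (GrpAlg K G)).compl₂ D := by
    refine linearMap_ext_of fun g => linearMap_ext_of fun g' => ?_
    simpa [aug] using h g g'
  exact LinearMap.congr_fun (LinearMap.congr_fun key a) b

theorem isRightDerivation_of_group {D : GrpAlg K G →ₗ[K] GrpAlg K G}
    (h : ∀ g g' : G, D (MonoidAlgebra.of K G (g * g')) =
      D (MonoidAlgebra.of K G g) * MonoidAlgebra.of K G g' + D (MonoidAlgebra.of K G g')) :
    IsRightDerivation D := by
  intro a b
  have key : (LinearMap.mul K (GrpAlg K G)).compr₂ D =
      LinearMap.mul K (GrpAlg K G) ∘ₗ D +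
        (LinearMap.lsmul K (GrpAlg K G) ∘ₗ (aug K G).toLinearMap).compl₂ D := by
    refine linearMap_ext_of fun g => linearMap_ext_of fun g' => ?_
    simpa [aug] using h g g'
  exact LinearMap.congr_fun (LinearMap.congr_fun key a) b

variable (K G) in
/-- The left `K[G]`-module of the right derivations of `K[G]`. -/
def rightCocycleRep : Rep.{u} K G :=
  Rep.of (X := rightCocycles (K := K) (MonoidAlgebra.of K G))
    { toFun := leftMul K (MonoidAlgebra.of K G)
      map_one' := by
        refine LinearMap.ext fun D => Subtype.ext (funext fun h => ?_)
        change MonoidAlgebra.of K G 1 * D.1 h = D.1 h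
        rw [map_one, one_mul]
      map_mul' g g' := by
        refine LinearMap.ext fun D => Subtype.ext (funext fun h => ?_)
        change MonoidAlgebra.of K G (g * g') * D.1 h =
          MonoidAlgebra.of K G g * (MonoidAlgebra.of K G g' * D.1 h)
        rw [map_mul, mul_assoc] }

/-- The Fox pairing defined by a 1-cocycle with values in the right derivations. -/
def foxOfCocycle (φ : G → rightCocycles (K := K) (MonoidAlgebra.of K G))
    (hφ : ∀ g g' h, (φ (g * g')).1 h =
      MonoidAlgebra.of K G g * (φ g').1 h + (φ g).1 h) : foxPairings K G :=
  ⟨linExt fun g => linExt (φ g).1, by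
    constructor
    · intro a₁ a₂ b
      -- For fixed `b`, the first Fox law is the left derivation law, and on `G` it is the cocycle
      -- identity of `φ`.
      refine isLeftDerivation_of_group (D := (linExt fun g => linExt (φ g).1).flip b)
        (fun g g' => ?_) a₁ a₂
      simp only [LinearMap.flip_apply, linExt_of]
      have key : linExt (K := K) (φ (g * g')).1 = linExt (φ g).1 +
          LinearMap.mulLeft K (MonoidAlgebra.of K G g) ∘ₗ linExt (φ g').1 := by
        refine linearMap_ext_of fun h => ?_
        simp only [LinearMap.add_apply, LinearMap.comp_apply, linExt_of, LinearMap.mulLeft_apply]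
        rw [hφ, add_comm]
      exact LinearMap.congr_fun key b
    · intro a
      -- The second law is linear in `a`; for `a = g` it says that `φ g` is a right cocycle.
      induction a using MonoidAlgebra.induction_on with
      | of g =>
        rw [linExt_of]
        refine isRightDerivation_of_group fun h h' => ?_
        simp only [linExt_of]
        exact (φ g).2 h h'
      | add a a' ha ha' =>
        intro b₁ b₂
        rw [map_add, LinearMap.add_apply, LinearMap.add_apply, LinearMap.add_apply, ha, ha',
          add_mul, smul_add]
        abel
      | smul r a ha =>
        intro b₁ b₂
        rw [map_smul, LinearMap.smul_apply, LinearMap.smul_apply, LinearMap.smul_apply, ha,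
          smul_add, smul_mul_assoc, smul_comm]⟩

theorem relClass_surjective {m : ℕ} (S : Fin m → Subgroup G) (M : Rep.{u} K G) (n : ℕ) :
    Function.Surjective (relClass S M n) :=
  Submodule.mkQ_surjective _

/-- Over a duality pair with a nonempty family of subgroups, every 1-cocycle of `G` in
`H¹(G; K[G])` is defined by a Fox pairing. -/
theorem IsPDPair.exists_foxCochain_eq {m : ℕ} {S : Fin m → Subgroup G} (hm : 0 < m)
    (hPD : IsPDPair (K := K) S 2) (f : Cochain (rightH1Rep K G) 1)
    (hf : f ∈ cocycles (coboundary (rightH1Rep K G)) 1) :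
    ∃ η : foxPairings K G, foxCochain η = f := by
  let p : rightCocycleRep K G →ₗ[K] rightH1Rep K G := rightH1Mk K (MonoidAlgebra.of K G)
  -- Lifting along `Z¹_r → B` chooses representatives of the classes `f g` that again satisfy the
  -- cocycle identity exactly.
  obtain ⟨φ, hφ, hφf⟩ := exists_lift_cocycle (hPD.subsingleton_cohomology_two hm) p
    (fun g D => rfl) f hf fun x => Submodule.Quotient.mk_surjective _ (f x)
  obtain ⟨φ, rfl⟩ : ∃ φ' : G → rightCocycleRep K G, φ = fun x => φ' (x 0) :=
    exists_cochain_one_eq _ φ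
  have hφ' := (mem_cocycles_one (rightCocycleRep K G) φ).1 hφ
  refine ⟨foxOfCocycle φ fun g g' h =>
    congrFun (congrArg Subtype.val (hφ' g g')) h, funext fun x => ?_⟩
  refine Eq.trans ?_ (hφf x)
  refine congrArg (rightH1Mk K (MonoidAlgebra.of K G)) (Subtype.ext (funext fun h => ?_))
  change linExt (fun g => linExt (K := K) (φ g).1) (MonoidAlgebra.of K G (x 0))
    (MonoidAlgebra.of K G h) = (φ (x 0)).1 h
  rw [linExt_of, linExt_of]

/-- Over a duality pair with a nonempty family of subgroups, every Fox pairing is a sum of Fox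
pairings of derivation type. -/
theorem IsPDPair.isSumOfDerivationPairings {m : ℕ} {S : Fin m → Subgroup G} (hm : 0 < m)
    (hPD : IsPDPair (K := K) S 2) (η : foxPairings K G) : IsSumOfDerivationPairings η := by
  obtain ⟨T, d, hd, hT⟩ := hPD.exists_dual_basis hm
  -- With `j` running through `T`, the summands are `d_j(a) η(j, b)`: every `ν` is the
  -- multiplication of `K[G]`.
  refine ⟨T.card, fun _ => LinearMap.mul K (GrpAlg K G), fun i => linExt (d (T.equivFin.symm i)),
    fun i => η.1 (MonoidAlgebra.of K G (T.equivFin.symm i)), fun i => ⟨?_, ?_, ?_⟩, fun a b => ?_⟩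
  · exact fun c x y => ⟨mul_assoc c x y, mul_assoc x c y, (mul_assoc x y c).symm⟩
  · refine isLeftDerivation_of_group fun g h => ?_
    simp only [linExt_of]
    exact hd _ g h
  · exact η.2.2 _
  · have hone : η.1 1 b = 0 := by
      have := η.2.1 1 1 b
      rw [map_one, one_smul, one_mul, one_mul] at this
      exact left_eq_add.1 this
    -- On the augmentation ideal `η(-, b)` is left linear, since `j - 1` has augmentation 0.
    have hsub : ∀ (j : G) (x : GrpAlg K G), η.1 (x * (MonoidAlgebra.of K G j - 1)) b =
        x * η.1 (MonoidAlgebra.of K G j) b := by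
      intro j x
      rw [η.2.1, map_sub, map_sub, aug_of, map_one, sub_self, zero_smul, zero_add,
        LinearMap.sub_apply, hone, sub_zero]
    have key : η.1.flip b = ∑ i : Fin T.card, LinearMap.mulRight K
        (η.1 (MonoidAlgebra.of K G (T.equivFin.symm i)) b) ∘ₗ linExt (d (T.equivFin.symm i)) := by
      refine linearMap_ext_of fun g => ?_
      simp only [LinearMap.flip_apply, LinearMap.sum_apply, LinearMap.comp_apply, linExt_of,
        LinearMap.mulRight_apply]
      rw [T.equivFin.symm.sum_comp fun j : T => d j g * η.1 (MonoidAlgebra.of K G j) b,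
        Finset.sum_coe_sort T fun j => d j g * η.1 (MonoidAlgebra.of K G j) b]
      -- Replaces `η(g, b)` by `η(g - 1, b)` in order to expand `g - 1` in the dual basis.
      rw [← sub_zero (η.1 _ b), ← hone, ← LinearMap.sub_apply, ← map_sub, hT, map_sum,
        LinearMap.sum_apply]
      exact Finset.sum_congr rfl fun j _ => hsub j _
    exact (LinearMap.congr_fun key a).trans (by simp [LinearMap.sum_apply])

end fox

end PDPair
end

theorem theorem4p6 {K G : Type u} [CommRing K] [Group G] {m : ℕ}
    (S : Fin m → Subgroup G) (hS : ∀ i j, i ≠ j → S i ⊓ S j = ⊥) (hm : 0 < m)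
    (hPD : PDPair.IsPDPair (K := K) S 2) :
    ((∀ c : PDPair.RelCohomology S (PDPair.rightH1Rep K G) 1,
        ∃ η : PDPair.foxPairings K G, PDPair.RepresentsRel S η c) ∧
      (∀ f ∈ PDPair.vanishingCocycles S (PDPair.rightH1Rep K G),
        ∃ η : PDPair.foxPairings K G, PDPair.foxCochain η = f) ∧
      (∀ c : PDPair.GrpCohomology (PDPair.rightH1Rep K G) 1,
        ∃ η : PDPair.foxPairings K G, PDPair.foxClass η = c)) ∧
    (IsDomain K ∧ IsPrincipalIdealRing K →
      (∀ c : PDPair.RelCohomology S (PDPair.rightH1Rep K G) 1,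
        ∃ η : PDPair.foxPairings K G,
          PDPair.IsSumOfDerivationPairings η ∧ PDPair.RepresentsRel S η c) ∧
      (∀ f ∈ PDPair.vanishingCocycles S (PDPair.rightH1Rep K G),
        ∃ η : PDPair.foxPairings K G,
          PDPair.IsSumOfDerivationPairings η ∧ PDPair.foxCochain η = f) ∧
      (∀ c : PDPair.GrpCohomology (PDPair.rightH1Rep K G) 1,
        ∃ η : PDPair.foxPairings K G,
          PDPair.IsSumOfDerivationPairings η ∧ PDPair.foxClass η = c)) := by
  have hrel : ∀ c : PDPair.RelCohomology S (PDPair.rightH1Rep K G) 1,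
      ∃ η : PDPair.foxPairings K G, PDPair.RepresentsRel S η c := by
    intro c
    obtain ⟨z, rfl⟩ := PDPair.relClass_surjective S _ 1 c
    -- The equality with `[η]` holds for cochains, so the elements `a_k` of the given relative
    -- cocycle are kept.
    obtain ⟨η, hη⟩ := hPD.exists_foxCochain_eq hm z.1.1 (congrArg Prod.fst z.2)
    exact ⟨η, z, hη.symm, rfl⟩
  have hvan : ∀ f ∈ PDPair.vanishingCocycles S (PDPair.rightH1Rep K G),
      ∃ η : PDPair.foxPairings K G, PDPair.foxCochain η = f := fun f hf =>
    hPD.exists_foxCochain_eq hm f hf.1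
  have habs : ∀ c : PDPair.GrpCohomology (PDPair.rightH1Rep K G) 1,
      ∃ η : PDPair.foxPairings K G, PDPair.foxClass η = c := by
    intro c
    obtain ⟨z, rfl⟩ := Submodule.Quotient.mk_surjective _ c
    obtain ⟨η, hη⟩ := hPD.exists_foxCochain_eq hm z.1 z.2
    exact ⟨η, congrArg Submodule.Quotient.mk (Subtype.ext hη)⟩
  have hsum := hPD.isSumOfDerivationPairings hm
  exact ⟨⟨hrel, hvan, habs⟩, fun _ => ⟨fun c => (hrel c).imp fun η h => ⟨hsum η, h⟩,
    fun f hf => (hvan f hf).imp fun η h => ⟨hsum η, h⟩,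
    fun c => (habs c).imp fun η h => ⟨hsum η, h⟩⟩⟩
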